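/- There are universal constants $c_1,c_2,K>0$ such that the following holds. Let $A,B,C$ be finite-dimensional quantum systems and let $\rho^{ABC}$ be a quantum state (density operator) with $\mathrm{Tr}_C[\rho^{ABC}]=\rho^A\otimes\rho^B$ (an $\mathsf{IM}$-state). Then for every $\varepsilon\in(0,1)$, $$I_H^{\varepsilon}(AB:C)\;\ge\; I_H^{\varepsilon'}(A:C)+I_H^{\varepsilon''}(B:AC)-K\log_2\frac{2}{\varepsilon},\qquad \varepsilon'=c_1\varepsilon^2,\quad \varepsilon''=c_2\varepsilon^2 .$$ In particular, the error term is $O(\log\varepsilon)$ as $\varepsilon\to0$, with constants that depend neither on the state nor on the dimensions. All quantities are evaluated on $\rho^{ABC}$ and its marginals. Here, for a bipartite state $\rho^{XY}$, $I_H^{\varepsilon}(X:Y)=D_H^{\varepsilon}(\rho^{XY}\,\|\,\rho^X\otimes\rho^Y)$ is the smooth hypothesis testing mutual information, where the smooth hypothesis testing relative entropy $D_H^{\varepsilon}$ is defined by $$2^{-D_H^{\varepsilon}(\rho\|\sigma)}=\min\{\mathrm{Tr}[\Pi\sigma] : 0\le\Pi\le \mathbb{I},\ \mathrm{Tr}[\Pi\rho]\ge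 1-\varepsilon\}$$ (with $D_H^{\varepsilon}=+\infty$ if the minimum is $0$). -/

import Mathlib

open scoped Kronecker ComplexOrder

noncomputable section

/-! Finite-dimensional quantum systems: a system with a finite index type `X` has Hilbert space
`ℂ^X`, a composite system `XY` is indexed by `X × Y`, and operators are complex matrices. -/

/-- Quantum states (density operators): positive semidefinite of trace one. -/
structure IsState {X : Type*} [Fintype X] (ρ : Matrix X X ℂ) : Prop where
  posSemidef : ρ.PosSemidef
  trace_eq_one : ρ.trace = 1

/-- The marginal on the first system of a bipartite operator: trace over the second system. -/
def marginalFst {X Y : Type*} [Fintype Y] (ρ : Matrix (X × Y) (X × Y) ℂ) : Matrix X X ℂ :=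
  Matrix.of fun x x' => ∑ y, ρ (x, y) (x', y)

/-- The marginal on the second system of a bipartite operator: trace over the first system. -/
def marginalSnd {X Y : Type*} [Fintype X] (ρ : Matrix (X × Y) (X × Y) ℂ) : Matrix Y Y ℂ :=
  Matrix.of fun y y' => ∑ x, ρ (x, y) (x, y')

/-- Tests `0 ≤ Π ≤ 1` (in the Loewner order) that accept `ρ` with probability at least `1 - ε`. -/
def acceptingTests {X : Type*} [Fintype X] [DecidableEq X] (ε : ℝ) (ρ : Matrix X X ℂ) :
    Set (Matrix X X ℂ) :=
  {P | P.PosSemidef ∧ (1 - P).PosSemidef ∧ 1 - ε ≤ (P * ρ).trace.re}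

/-- The least value of `Tr (Π σ)` over the tests `Π` that accept `ρ` with probability at least
`1 - ε`. -/
def minTestValue {X : Type*} [Fintype X] [DecidableEq X] (ε : ℝ) (ρ σ : Matrix X X ℂ) : ℝ :=
  sInf ((fun P : Matrix X X ℂ => (P * σ).trace.re) '' acceptingTests ε ρ)

open Classical in
/-- The smooth hypothesis testing relative entropy `D_H^ε(ρ ‖ σ)`, in bits:
`2 ^ (-D_H^ε(ρ ‖ σ)) = min Tr (Π σ)`. It is `+∞` when the minimum is `0`. -/
def hypothesisTestingEntropy {X : Type*} [Fintype X] [DecidableEq X] (ε : ℝ)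
    (ρ σ : Matrix X X ℂ) : EReal :=
  if minTestValue ε ρ σ = 0 then ⊤ else ((-Real.logb 2 (minTestValue ε ρ σ) : ℝ) : EReal)

/-- The smooth hypothesis testing mutual information
`I_H^ε(X : Y)_ρ = D_H^ε(ρ^{XY} ‖ ρ^X ⊗ ρ^Y)` of a bipartite state. -/
def hypothesisTestingInfo {X Y : Type*} [Fintype X] [Fintype Y] [DecidableEq X] [DecidableEq Y]
    (ε : ℝ) (ρ : Matrix (X × Y) (X × Y) ℂ) : EReal :=
  hypothesisTestingEntropy ε ρ (marginalFst ρ ⊗ₖ marginalSnd ρ)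

/-- The marginal `ρ^{AC}` of a tripartite operator `ρ^{ABC}`: trace over `B`. -/
def marginalAC {A B C : Type*} [Fintype B] (ρ : Matrix ((A × B) × C) ((A × B) × C) ℂ) :
    Matrix (A × C) (A × C) ℂ :=
  Matrix.of fun x x' => ∑ b, ρ ((x.1, b), x.2) ((x'.1, b), x'.2)

/-- The operator `ρ^{ABC}` regarded as a bipartite operator on the systems `B` and `AC`. -/
def regroupBAC {A B C : Type*} (ρ : Matrix ((A × B) × C) ((A × B) × C) ℂ) :
    Matrix (B × (A × C)) (B × (A × C)) ℂ :=
  ρ.submatrix (fun x => ((x.2.1, x.1), x.2.2)) (fun x => ((x.2.1, x.1), x.2.2))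

/-- IM-states: tripartite states with `ρ^{AB} = ρ^A ⊗ ρ^B`. -/
def IsIMState {A B C : Type*} [Fintype A] [Fintype B] [Fintype C]
    (ρ : Matrix ((A × B) × C) ((A × B) × C) ℂ) : Prop :=
  IsState ρ ∧
    marginalFst ρ = marginalFst (marginalFst ρ) ⊗ₖ marginalSnd (marginalFst ρ)

end

/-! Regroup the state as τ on B and AC. Independence of A and B turns ρ^{AB} ⊗ ρ^C into ρ^B ⊗ σ with
σ = ρ^A ⊗ ρ^C, so the claim is a chain rule for tests: an error for τ against ρ^B ⊗ σ is bounded by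
the product of the errors for ρ^{AC} against σ and for τ against ρ^B ⊗ ρ^{AC}, up to a factor 1/δ
(`minTestValue_mul_le`).

The composite test comes from `exists_composite_test`. Let E project onto the nonnegative part of
μρ^{AC} - σ. By Neyman-Pearson optimality E accepts ρ^{AC} with high probability, and EσE ≤ μ
Eρ^{AC}E. Since Eρ^{AC}E need not lie below ρ^{AC}, `exists_recovery` supplies a contraction U with
UE = U and U(Eρ^{AC}E)Uᴴ ≤ ρ^{AC}; hence UσUᴴ ≤ μρ^{AC}. Acting with U on AC and then applying a
test Q gains the factor μ, while U barely disturbs τ. -/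

open Matrix
open scoped MatrixOrder

/-! ### Traces and the Loewner order. -/

section TraceInequalities

variable {n : Type*} [Fintype n]

theorem trace_mul_posSemidef_nonneg {X Y : Matrix n n ℂ} (hX : X.PosSemidef) (hY : Y.PosSemidef) :
    0 ≤ (X * Y).trace.re := by
  classical
  have hr : (CFC.sqrt Y).PosSemidef := (CFC.sqrt_nonneg Y).posSemidef
  have h : (X * Y).trace = (CFC.sqrt Y * X * (CFC.sqrt Y)ᴴ).trace := by
    rw [hr.1.eq, trace_mul_comm, mul_assoc, trace_mul_comm (CFC.sqrt Y), mul_assoc, CFC.sqrt_mul_sqrt_self Y hY.nonneg, trace_mul_comm]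
  rw [h]
  exact (Complex.le_def.1 (hX.mul_mul_conjTranspose_same _).trace_nonneg).1

theorem trace_mul_le_of_posSemidef_sub {X Y Z : Matrix n n ℂ} (hX : X.PosSemidef)
    (h : (Z - Y).PosSemidef) : (X * Y).trace.re ≤ (X * Z).trace.re := by
  have := trace_mul_posSemidef_nonneg hX h
  rw [mul_sub, trace_sub, Complex.sub_re] at this
  linarith

theorem trace_conjTranspose_mul_self_add_le (X Y : Matrix n n ℂ) :
    ((X + Y)ᴴ * (X + Y)).trace.re ≤ 2 * (Xᴴ * X).trace.re + 2 * (Yᴴ * Y).trace.re := by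
  have h := (Complex.le_def.1 (posSemidef_conjTranspose_mul_self (X - Y)).trace_nonneg).1
  simp only [conjTranspose_add, conjTranspose_sub, add_mul, mul_add, sub_mul, mul_sub, trace_add,
    trace_sub, Complex.add_re, Complex.sub_re, Complex.zero_re] at h ⊢
  linarith

/-- Operator monotonicity of the square root. -/
theorem le_of_mul_self_le {c d : Matrix n n ℂ} (hc : c.PosSemidef) (hd : d.PosSemidef)
    (h : (c * c - d * d).PosSemidef) : (c - d).PosSemidef := by
  classical
  open scoped Matrix.Norms.L2Operator in
  have := CFC.sqrt_le_sqrt _ _ (le_iff.2 h)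
  rw [CFC.sqrt_mul_self d hd.nonneg, CFC.sqrt_mul_self c hc.nonneg] at this
  exact le_iff.1 this

end TraceInequalities

/-! ### Functional calculus of a Hermitian matrix. -/

section SpectralCalculus

variable {n : Type*} [Fintype n] [DecidableEq n] {H : Matrix n n ℂ} (hH : H.IsHermitian)

theorem cfc_mul_cfc (f g : ℝ → ℝ) : hH.cfc f * hH.cfc g = hH.cfc (fun x => f x * g x) := by
  simp only [IsHermitian.cfc]
  rw [← map_mul, diagonal_mul_diagonal]
  congr 2
  ext i
  simp

theorem cfc_sub_cfc (f g : ℝ → ℝ) : hH.cfc f - hH.cfc g = hH.cfc (fun x => f x - g x) := by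
  simp only [IsHermitian.cfc]
  rw [← map_sub, diagonal_sub]
  congr 2
  ext i
  simp

theorem cfc_self : hH.cfc (fun x => x) = H := hH.spectral_theorem.symm

theorem cfc_one_fun : hH.cfc (fun _ => 1) = 1 := by
  simp only [IsHermitian.cfc]
  rw [← map_one (Unitary.conjStarAlgAut ℂ (Matrix n n ℂ) hH.eigenvectorUnitary)]
  congr 1

theorem cfc_congr_eigenvalues {f g : ℝ → ℝ} (h : ∀ i, f (hH.eigenvalues i) = g (hH.eigenvalues i)) :
    hH.cfc f = hH.cfc g := by
  simp only [IsHermitian.cfc]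
  congr 2
  ext i
  simp [h]

theorem cfc_posSemidef {f : ℝ → ℝ} (h : ∀ i, 0 ≤ f (hH.eigenvalues i)) :
    (hH.cfc f).PosSemidef := by
  simp only [IsHermitian.cfc, Unitary.conjStarAlgAut_apply]
  refine PosSemidef.mul_mul_conjTranspose_same (PosSemidef.diagonal fun i => ?_) _
  simpa using h i

theorem cfc_isHermitian (f : ℝ → ℝ) : (hH.cfc f).IsHermitian := by
  simp only [IsHermitian.cfc, Unitary.conjStarAlgAut_apply]
  refine isHermitian_mul_mul_conjTranspose _ ?_
  rw [isHermitian_diagonal_iff]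
  intro i
  simp [isSelfAdjoint_iff]

/-- The spectral projection of a Hermitian matrix onto its nonnegative part is an optimal test. -/
theorem exists_nonneg_projection {H : Matrix n n ℂ} (hH : H.IsHermitian) :
    ∃ P : Matrix n n ℂ, P.IsHermitian ∧ P * P = P ∧ (P * H * P).PosSemidef ∧
      ∀ Q : Matrix n n ℂ, Q.PosSemidef → (1 - Q).PosSemidef →
        (Q * H).trace.re ≤ (P * H).trace.re := by
  let p : ℝ → ℝ := fun x => if 0 ≤ x then 1 else 0
  have hpp : hH.cfc p * hH.cfc p = hH.cfc p := by
    rw [cfc_mul_cfc]; congr 1; ext x; simp [p]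
  have hpH : hH.cfc p * H = hH.cfc (fun x => p x * x) := by
    rw [← cfc_mul_cfc, cfc_self hH]
  have hpos : (hH.cfc p * H).PosSemidef := by
    rw [hpH]
    refine cfc_posSemidef hH fun i => ?_
    by_cases h : 0 ≤ hH.eigenvalues i <;> simp [p, h]
  have hneg : (hH.cfc p * H - H).PosSemidef := by
    have : hH.cfc p * H - H = hH.cfc (fun x => p x * x - x) := by
      rw [hpH, ← cfc_sub_cfc, cfc_self hH]
    rw [this]
    refine cfc_posSemidef hH fun i => ?_
    by_cases h : 0 ≤ hH.eigenvalues i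
    · simp [p, h]
    · simp only [p, h, if_false]; linarith
  refine ⟨hH.cfc p, cfc_isHermitian hH p, hpp, ?_, fun Q hQ hQ' => ?_⟩
  · have : hH.cfc p * H * hH.cfc p = hH.cfc p * H := by
      rw [hpH, cfc_mul_cfc]; congr 1; ext x; by_cases h : 0 ≤ x <;> simp [p, h]
    rwa [this]
  -- With H₊ = PH the positive part, Tr QH ≤ Tr QH₊ ≤ Tr H₊.
  · have h1 := trace_mul_posSemidef_nonneg hQ hneg
    have h2 := trace_mul_posSemidef_nonneg hQ' hpos
    simp only [mul_sub, sub_mul, one_mul, trace_sub, Complex.sub_re] at h1 h2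
    linarith

end SpectralCalculus

/-! ### Polar decomposition and recovery after a projection. -/

section Polar

variable {n : Type*} [Fintype n] [DecidableEq n]

/-- Polar decomposition `M = U c`, with `U` a partial isometry whose initial projection factors
through `c`. -/
theorem exists_polar (M : Matrix n n ℂ) :
    ∃ U c g : Matrix n n ℂ, c.PosSemidef ∧ c * c = Mᴴ * M ∧ U * c = M ∧
      (1 - Uᴴ * U).PosSemidef ∧ Uᴴ * U = g * c ∧ Uᴴ * U * c = c := by
  have hN := posSemidef_conjTranspose_mul_self M
  have hev := hN.eigenvalues_nonneg
  set N := Mᴴ * M with hNdef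
  let H := hN.1
  let c := H.cfc (fun x => √x)
  -- As 0⁻¹ = 0, `g` is the pseudo-inverse of `c`, and `s` is the support projection of `c`.
  let g := H.cfc (fun x => (√x)⁻¹)
  let s := H.cfc (fun x => √x * (√x)⁻¹)
  have hcc : c * c = N := by
    rw [cfc_mul_cfc]
    exact (cfc_congr_eigenvalues H fun i => Real.mul_self_sqrt (hev i)).trans (cfc_self H)
  have hcg : c * g = s := cfc_mul_cfc H _ _
  have hgc : g * c = s := by
    rw [cfc_mul_cfc]; congr 1; ext x; ring
  have hsc : s * c = c := by
    rw [cfc_mul_cfc]; congr 1; ext x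
    by_cases h : √x = 0 <;> simp [h]
  have hcs : c * s = c := by
    rw [cfc_mul_cfc]; congr 1; ext x
    by_cases h : √x = 0 <;> simp [h]
  have hg : gᴴ = g := (cfc_isHermitian H _).eq
  have hs : sᴴ = s := (cfc_isHermitian H _).eq
  have hU : (M * g)ᴴ * (M * g) = s := by
    rw [conjTranspose_mul, hg, mul_assoc, ← mul_assoc Mᴴ, ← hNdef, ← hcc, mul_assoc c, hcg, hcs, hgc]
  have hMs : M * s = M := by
    have h0 : (M * (1 - s))ᴴ * (M * (1 - s)) = 0 := by
      rw [conjTranspose_mul, mul_assoc, ← mul_assoc Mᴴ, ← hNdef, ← hcc, mul_assoc c, mul_sub c, hcs]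
      simp
    have := conjTranspose_mul_self_eq_zero.1 h0
    rw [mul_sub, mul_one, sub_eq_zero] at this
    exact this.symm
  refine ⟨M * g, c, g, cfc_posSemidef H fun i => Real.sqrt_nonneg _, hcc, ?_, ?_, ?_, ?_⟩
  · rw [mul_assoc, hgc, hMs]
  · rw [hU, ← cfc_one_fun H, cfc_sub_cfc]
    refine cfc_posSemidef H fun i => ?_
    by_cases h : √(H.eigenvalues i) = 0 <;> simp [h]
  · rw [hU, hgc]
  · rw [hU, hsc]

/-- A projection `P` that `ρ` almost surely passes can be followed by a contraction that undoes the
disturbance of `ρ` in the Loewner order, while staying close to the identity on `ρ` with a loss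
that is linear in the failure probability. -/
theorem exists_recovery {ρ P : Matrix n n ℂ} (hρ : ρ.PosSemidef) (hP : P.IsHermitian)
    (hPP : P * P = P) :
    ∃ U : Matrix n n ℂ, (1 - Uᴴ * U).PosSemidef ∧ U * P = U ∧
      (ρ - U * (P * ρ * P) * Uᴴ).PosSemidef ∧
      (U * ρ * Uᴴ).trace.re = (P * ρ).trace.re ∧
      ((U - 1) * ρ * (U - 1)ᴴ).trace.re ≤ 8 * ((1 - P) * ρ).trace.re := by
  obtain ⟨a, ha, haa⟩ : ∃ a : Matrix n n ℂ, a.PosSemidef ∧ a * a = ρ :=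
    ⟨CFC.sqrt ρ, (CFC.sqrt_nonneg ρ).posSemidef, CFC.sqrt_mul_sqrt_self ρ hρ.nonneg⟩
  -- With a = √ρ and aP = Uc one has c² = PρP, so U(PρP)Uᴴ = aPa ≤ a² = ρ.
  obtain ⟨U, c, g, hc, hcc, hUc, hU1, hUg, hUUc⟩ := exists_polar (a * P)
  have hQ : (1 - P).IsHermitian := isHermitian_one.sub hP
  have hQQ : (1 - P) * (1 - P) = 1 - P := by
    rw [mul_sub, sub_mul, sub_mul, hPP]; simp
  have hQsd : (1 - P).PosSemidef := by
    have := posSemidef_conjTranspose_mul_self (1 - P)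
    rwa [hQ.eq, hQQ] at this
  have hcc' : c * c = P * ρ * P := by
    rw [hcc, conjTranspose_mul, hP.eq, ha.1.eq, ← haa]; simp only [mul_assoc]
  have hcP : c * P = c := by
    have h0 : (c * (1 - P))ᴴ * (c * (1 - P)) = 0 := by
      rw [conjTranspose_mul, hc.1.eq, mul_assoc, ← mul_assoc c, hcc', mul_assoc (P * ρ), mul_sub P,
        hPP]
      simp
    have := conjTranspose_mul_self_eq_zero.1 h0
    rw [mul_sub, mul_one, sub_eq_zero] at this
    exact this.symm
  have hPc : P * c = c := by
    have := congrArg conjTranspose hcP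
    rwa [conjTranspose_mul, hP.eq, hc.1.eq] at this
  have hsP : Uᴴ * U * P = Uᴴ * U := by rw [hUg, mul_assoc, hcP]
  have hPs : P * (Uᴴ * U) = Uᴴ * U := by
    have := congrArg conjTranspose hsP
    rwa [conjTranspose_mul, conjTranspose_mul, conjTranspose_conjTranspose, hP.eq] at this
  have hUP : U * P = U := by
    have h0 : (U * (1 - P))ᴴ * (U * (1 - P)) = 0 := by
      rw [conjTranspose_mul, mul_assoc, ← mul_assoc Uᴴ, mul_sub (Uᴴ * U), hsP]
      simp
    have := conjTranspose_mul_self_eq_zero.1 h0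
    rw [mul_sub, mul_one, sub_eq_zero] at this
    exact this.symm
  refine ⟨U, hU1, hUP, ?_, ?_, ?_⟩
  · have h1 : U * (P * ρ * P) * Uᴴ = a * P * a := by
      rw [← hcc', ← mul_assoc, hUc, mul_assoc, ← hc.1.eq, ← conjTranspose_mul, hUc,
        conjTranspose_mul, hP.eq, ha.1.eq, ← mul_assoc, mul_assoc a P P, hPP]
    have h2 : ρ - U * (P * ρ * P) * Uᴴ = a * (1 - P) * aᴴ := by
      rw [h1, ha.1.eq, mul_sub, sub_mul, mul_one, haa]
    rw [h2]
    exact hQsd.mul_mul_conjTranspose_same a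
  · have h1 : (U * ρ * Uᴴ).trace = (Uᴴ * U * (c * c)).trace := by
      rw [trace_mul_comm, ← mul_assoc, hcc', ← mul_assoc, ← mul_assoc, hsP, trace_mul_comm _ P,
        ← mul_assoc, hPs]
    rw [h1, ← mul_assoc, hUUc, hcc', trace_mul_comm, ← mul_assoc, hPP]
  · have htcc : (c * c).trace = (P * ρ).trace := by
      rw [hcc', trace_mul_comm, ← mul_assoc, hPP]
    -- compare `c = |a P|` with `P a P`
    have hd : (P * a * P).PosSemidef := by
      have := ha.conjTranspose_mul_mul_same P
      rwa [hP.eq] at this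
    have hdc : (c - P * a * P).PosSemidef := by
      refine le_of_mul_self_le hc hd ?_
      have : c * c - P * a * P * (P * a * P) = (P * a) * (1 - P) * (P * a)ᴴ := by
        rw [hcc', conjTranspose_mul, hP.eq, ha.1.eq, ← haa, mul_sub, sub_mul, mul_one]
        congr 1
        · simp only [mul_assoc]
        · simp only [mul_assoc]; rw [← mul_assoc P P, hPP]
      rw [this]
      exact hQsd.mul_mul_conjTranspose_same _
    have hac : (a * c).trace = (P * a * P * c).trace := by
      rw [mul_assoc, hPc, mul_assoc, trace_mul_comm P, mul_assoc, hcP]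
    have h1 := trace_mul_le_of_posSemidef_sub hd hdc
    rw [← hac] at h1
    have hdd : (P * a * P * (P * a * P)).trace = (a * P * a * P).trace := by
      rw [trace_mul_comm]
      have : P * a * P * (P * a * P) = P * (a * P * a * P) := by
        simp only [mul_assoc]; rw [← mul_assoc P P, hPP]
      rw [this, trace_mul_comm, mul_assoc (a * P * a), hPP]
    -- Expanded, this gives Tr aPaP ≥ 2 Tr Pρ - Tr ρ. As Tr ac ≥ Tr aPaP, it follows that ‖a - c‖² ≤
    -- 3η in Hilbert-Schmidt norm, where η = Tr (1 - P)ρ.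
    have h2 : 0 ≤ (a * (1 - P) * a * (1 - P)).trace.re := by
      have h := trace_mul_posSemidef_nonneg (hQsd.mul_mul_conjTranspose_same a) hQsd
      rwa [ha.1.eq] at h
    have h3 : (a * (1 - P) * a * (1 - P)).trace
        = ρ.trace - 2 * (P * ρ).trace + (a * P * a * P).trace := by
      simp only [mul_sub, sub_mul, mul_one, trace_sub]
      rw [haa, trace_mul_comm (a * P) a, ← mul_assoc, haa, trace_mul_comm ρ P]
      ring
    have h4 : ((a - c)ᴴ * (a - c)).trace
        = ρ.trace + (P * ρ).trace - 2 * (a * c).trace := by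
      rw [conjTranspose_sub, ha.1.eq, hc.1.eq]
      simp only [mul_sub, sub_mul, trace_sub]
      rw [haa, htcc, trace_mul_comm c a]
      ring
    have h5 : ((a * P - a)ᴴ * (a * P - a)).trace = ((1 - P) * ρ).trace := by
      have : a * P - a = -(a * (1 - P)) := by rw [mul_sub, mul_one, neg_sub]
      rw [this, conjTranspose_neg, neg_mul_neg, conjTranspose_mul, hQ.eq, ha.1.eq, mul_assoc,
        ← mul_assoc a, haa, trace_mul_comm, mul_assoc, hQQ, trace_mul_comm]
    have h6 : ((U * (a - c))ᴴ * (U * (a - c))).trace.re ≤ ((a - c)ᴴ * (a - c)).trace.re := by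
      have h := (Complex.le_def.1 (hU1.conjTranspose_mul_mul_same (a - c)).trace_nonneg).1
      rw [mul_sub ((a - c)ᴴ), sub_mul _ _ (a - c), trace_sub, Complex.sub_re, Complex.zero_re,
        mul_one] at h
      rw [conjTranspose_mul, mul_assoc, ← mul_assoc Uᴴ, ← mul_assoc]
      linarith
    have h7 : ((U - 1) * ρ * (U - 1)ᴴ).trace = (((U - 1) * a)ᴴ * ((U - 1) * a)).trace := by
      rw [trace_mul_comm _ ((U - 1) * a), conjTranspose_mul, ha.1.eq, ← haa]
      simp only [mul_assoc]
    -- The two terms have squared norms at most 3η and exactly η, whence 8 = 2 · 3 + 2 · 1.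
    have h8 : (U - 1) * a = U * (a - c) + (a * P - a) := by
      rw [mul_sub, hUc, sub_mul, one_mul]; abel
    rw [h7, h8]
    refine (trace_conjTranspose_mul_self_add_le _ _).trans ?_
    rw [h5]
    rw [h3] at h2
    rw [h4] at h6
    rw [hdd] at h1
    simp only [sub_mul, one_mul, trace_sub, Complex.add_re, Complex.sub_re, Complex.mul_re,
      Complex.re_ofNat, Complex.im_ofNat, zero_mul, sub_zero] at h2 h6 ⊢
    linarith

end Polar

/-! ### Partial traces. -/

section Marginals

variable {B D : Type*}

theorem marginalSnd_posSemidef [Fintype B] {τ : Matrix (B × D) (B × D) ℂ} (hτ : τ.PosSemidef) :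
    (marginalSnd τ).PosSemidef := by
  have : marginalSnd τ = ∑ b, τ.submatrix (fun d => (b, d)) (fun d => (b, d)) := by
    ext d d'; simp [marginalSnd, Matrix.sum_apply]
  rw [this]
  exact posSemidef_sum _ fun b _ => hτ.submatrix _

theorem marginalFst_posSemidef [Fintype D] {τ : Matrix (B × D) (B × D) ℂ} (hτ : τ.PosSemidef) :
    (marginalFst τ).PosSemidef := by
  have : marginalFst τ = ∑ d, τ.submatrix (fun b => (b, d)) (fun b => (b, d)) := by
    ext d d'; simp [marginalFst, Matrix.sum_apply]
  rw [this]
  exact posSemidef_sum _ fun b _ => hτ.submatrix _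

theorem kronecker_sub_right (X : Matrix B B ℂ) (Y Z : Matrix D D ℂ) :
    X ⊗ₖ (Y - Z) = X ⊗ₖ Y - X ⊗ₖ Z := by
  ext i j
  simp [mul_sub]

variable [Fintype B] [Fintype D]

theorem trace_one_kronecker_mul [DecidableEq B] (W : Matrix D D ℂ) (τ : Matrix (B × D) (B × D) ℂ) :
    (((1 : Matrix B B ℂ) ⊗ₖ W) * τ).trace = (W * marginalSnd τ).trace := by
  have h : ∀ b d, (((1 : Matrix B B ℂ) ⊗ₖ W) * τ) (b, d) (b, d)
      = ∑ d', W d d' * τ (b, d') (b, d) := fun b d => by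
    rw [mul_apply, Fintype.sum_prod_type, Finset.sum_eq_single b]
    · simp
    · intro b' _ hb
      simp [one_apply_ne hb.symm]
    · simp
  simp only [trace, diag_apply, Fintype.sum_prod_type, h, mul_apply, marginalSnd, of_apply,
    Finset.mul_sum]
  rw [Finset.sum_comm]
  exact Finset.sum_congr rfl fun d _ => Finset.sum_comm

theorem trace_marginalSnd (τ : Matrix (B × D) (B × D) ℂ) : (marginalSnd τ).trace = τ.trace := by
  simp only [trace, diag_apply, marginalSnd, of_apply, Fintype.sum_prod_type]
  exact Finset.sum_comm

/-- Reduces the disturbance of τ by a local operator to that of its marginal. -/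
theorem trace_one_kronecker_conj [DecidableEq B] (W : Matrix D D ℂ)
    (τ : Matrix (B × D) (B × D) ℂ) :
    (((1 : Matrix B B ℂ) ⊗ₖ W) * τ * ((1 : Matrix B B ℂ) ⊗ₖ W)ᴴ).trace
      = (W * marginalSnd τ * Wᴴ).trace := by
  rw [trace_mul_comm, ← mul_assoc, conjTranspose_kronecker, conjTranspose_one, ← mul_kronecker_mul,
    one_mul, trace_one_kronecker_mul, trace_mul_comm (W * _), mul_assoc]

end Marginals

/-! ### Composition of tests and optimal errors. -/

section Tests

variable {B D : Type*} [Fintype B] [Fintype D] [DecidableEq B] [DecidableEq D]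

/-- The test is T = Vᴴ Q V with V = 1 ⊗ U. If η ≤ ε₁ + δ is the failure probability of E, acceptance
loses η from Tr VτVᴴ, and 2ε₂ + 2 · 8η from Q rejecting VτVᴴ; hence 17. -/
theorem exists_composite_test {τ : Matrix (B × D) (B × D) ℂ} (hτ : IsState τ)
    {σ : Matrix D D ℂ} (hσ : σ.PosSemidef) {ε₁ ε₂ δ μ : ℝ} (hμ : 0 < μ)
    {P : Matrix D D ℂ} (hP : P ∈ acceptingTests ε₁ (marginalSnd τ))
    {Q : Matrix (B × D) (B × D) ℂ} (hQ : Q ∈ acceptingTests ε₂ τ)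
    (hPσ : (P * σ).trace.re ≤ μ * δ) :
    ∃ T ∈ acceptingTests (17 * (ε₁ + δ) + 2 * ε₂) τ,
      (T * (marginalFst τ ⊗ₖ σ)).trace.re
        ≤ μ * (Q * (marginalFst τ ⊗ₖ marginalSnd τ)).trace.re := by
  obtain ⟨hP0, hP1, hPρ⟩ := hP
  obtain ⟨hQ0, hQ1, hQτ⟩ := hQ
  have hρ := marginalSnd_posSemidef hτ.posSemidef
  have hω := marginalFst_posSemidef hτ.posSemidef
  have hρ1 : (marginalSnd τ).trace = 1 := (trace_marginalSnd τ).trans hτ.trace_eq_one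
  set ρ := marginalSnd τ
  set ω := marginalFst τ
  have hμρ : ((μ : ℂ) • ρ).PosSemidef := hρ.smul (by exact_mod_cast hμ.le)
  obtain ⟨E, hE, hEE, hEH, hEopt⟩ := exists_nonneg_projection (hμρ.1.sub hσ.1)
  have hE0 : E.PosSemidef := by
    have := posSemidef_conjTranspose_mul_self E
    rwa [hE.eq, hEE] at this
  have hη : ((1 - E) * ρ).trace.re = 1 - (E * ρ).trace.re := by
    rw [sub_mul, one_mul, trace_sub, hρ1]; simp
  -- Neyman-Pearson: Tr E(μρ - σ) ≥ Tr P(μρ - σ) ≥ μ(1 - ε₁ - δ), and Tr Eσ ≥ 0.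
  have hη' : 1 - (E * ρ).trace.re ≤ ε₁ + δ := by
    have h := hEopt P hP0 hP1
    have h0 := trace_mul_posSemidef_nonneg hE0 hσ
    simp only [mul_sub, mul_smul_comm, trace_sub, trace_smul, Complex.sub_re, smul_eq_mul,
      Complex.re_ofReal_mul] at h
    have : μ * (1 - (E * ρ).trace.re) ≤ μ * (ε₁ + δ) := by
      nlinarith [mul_le_mul_of_nonneg_left hPρ hμ.le]
    exact le_of_mul_le_mul_left this hμ
  obtain ⟨U, hU1, hUE, hUρ, hUtr, hUclose⟩ := exists_recovery hρ hE hEE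
  rw [hη] at hUclose
  set V : Matrix (B × D) (B × D) ℂ := 1 ⊗ₖ U with hV
  have hV1 : (1 - Vᴴ * V).PosSemidef := by
    have h := (PosSemidef.one (n := B) (R := ℂ)).kronecker hU1
    have h' : (1 : Matrix B B ℂ) ⊗ₖ (1 - Uᴴ * U) = 1 - Vᴴ * V := by
      rw [hV, conjTranspose_kronecker, ← mul_kronecker_mul, conjTranspose_one, one_mul,
        ← one_kronecker_one, kronecker_sub_right]
    rwa [h'] at h
  have hV2 : (1 : Matrix B B ℂ) ⊗ₖ (U - 1) = V - 1 := by
    rw [hV, ← one_kronecker_one, kronecker_sub_right]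
  refine ⟨Vᴴ * Q * V, ⟨hQ0.conjTranspose_mul_mul_same V, ?_, ?_⟩, ?_⟩
  · have : 1 - Vᴴ * Q * V = (1 - Vᴴ * V) + Vᴴ * (1 - Q) * V := by
      rw [mul_sub, sub_mul, mul_one]; abel
    rw [this]
    exact hV1.add (hQ1.conjTranspose_mul_mul_same V)
  · have h1 : (Vᴴ * Q * V * τ).trace
        = (V * τ * Vᴴ).trace - ((1 - Q) * (V * τ * Vᴴ)).trace := by
      rw [sub_mul, one_mul, trace_sub, sub_sub_cancel, mul_assoc, mul_assoc, trace_mul_comm Vᴴ,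
        mul_assoc]
    -- The operator equals (V - 2) τ (V - 2)ᴴ.
    have h2 : ((2 : ℂ) • τ + (2 : ℂ) • ((V - 1) * τ * (V - 1)ᴴ) - V * τ * Vᴴ).PosSemidef := by
      have h := hτ.posSemidef.mul_mul_conjTranspose_same (V - 1 - 1)
      convert h using 1
      simp only [conjTranspose_sub, conjTranspose_one, mul_sub, sub_mul,
        mul_one, one_mul, smul_sub, two_smul]
      abel
    have h3 := trace_mul_le_of_posSemidef_sub hQ1 h2
    have h4 : ((1 - Q) * ((V - 1) * τ * (V - 1)ᴴ)).trace.re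
        ≤ ((V - 1) * τ * (V - 1)ᴴ).trace.re := by
      have := trace_mul_posSemidef_nonneg hQ0
        (hτ.posSemidef.mul_mul_conjTranspose_same (V - 1))
      rw [sub_mul, one_mul, trace_sub, Complex.sub_re]
      linarith
    have h5 : ((V - 1) * τ * (V - 1)ᴴ).trace = ((U - 1) * ρ * (U - 1)ᴴ).trace := by
      rw [← hV2]; exact trace_one_kronecker_conj _ _
    have h6 : (V * τ * Vᴴ).trace = (U * ρ * Uᴴ).trace := trace_one_kronecker_conj _ _
    have h7 : ((1 - Q) * τ).trace.re = 1 - (Q * τ).trace.re := by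
      rw [sub_mul, one_mul, trace_sub, hτ.trace_eq_one]; simp
    rw [h1, h6, Complex.sub_re, hUtr]
    rw [h5] at h4
    simp only [mul_add, mul_smul_comm, trace_add, trace_smul, Complex.add_re, smul_eq_mul,
      Complex.mul_re, Complex.re_ofNat, Complex.im_ofNat, zero_mul, sub_zero, h7] at h3
    linarith
  · have h1 : (Vᴴ * Q * V * (ω ⊗ₖ σ)).trace = (Q * (ω ⊗ₖ (U * σ * Uᴴ))).trace := by
      rw [mul_assoc, mul_assoc, trace_mul_comm, mul_assoc, mul_assoc, hV, conjTranspose_kronecker,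
        conjTranspose_one, ← mul_kronecker_mul, ← mul_kronecker_mul, one_mul, mul_one, mul_assoc]
    have h2 : ((μ : ℂ) • ρ - U * σ * Uᴴ).PosSemidef := by
      have h : (μ : ℂ) • ρ - U * σ * Uᴴ = U * (E * ((μ : ℂ) • ρ - σ) * E) * Uᴴ
          + (μ : ℂ) • (ρ - U * (E * ρ * E) * Uᴴ) := by
        have hEU : E * Uᴴ = Uᴴ := by
          have := congrArg conjTranspose hUE
          rwa [conjTranspose_mul, hE.eq] at this
        have h' : ∀ X : Matrix D D ℂ, U * (E * X * E) * Uᴴ = U * X * Uᴴ := fun X => by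
          rw [mul_assoc, mul_assoc, hEU, ← mul_assoc, ← mul_assoc, hUE]
        rw [h', h', mul_sub, sub_mul, smul_sub, mul_smul_comm, smul_mul_assoc]
        abel
      rw [h]
      exact (hEH.mul_mul_conjTranspose_same U).add (hUρ.smul (by exact_mod_cast hμ.le))
    have h3 : (ω ⊗ₖ ((μ : ℂ) • ρ) - ω ⊗ₖ (U * σ * Uᴴ)).PosSemidef := by
      have h := hω.kronecker h2
      rwa [kronecker_sub_right] at h
    have h4 := trace_mul_le_of_posSemidef_sub hQ0 h3
    rw [h1]
    rwa [kronecker_smul, mul_smul_comm, trace_smul, smul_eq_mul, Complex.re_ofReal_mul] at h4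

variable {X : Type*} [Fintype X] [DecidableEq X]

theorem one_mem_acceptingTests {ε : ℝ} (hε : 0 ≤ ε) {ρ : Matrix X X ℂ} (hρ : ρ.trace = 1) :
    1 ∈ acceptingTests ε ρ :=
  ⟨PosSemidef.one, by simpa using PosSemidef.zero, by simpa [hρ] using hε⟩

theorem bddBelow_testValues {ε : ℝ} {ρ σ : Matrix X X ℂ} (hσ : σ.PosSemidef) :
    BddBelow ((fun P : Matrix X X ℂ => (P * σ).trace.re) '' acceptingTests ε ρ) :=
  ⟨0, by rintro _ ⟨P, hP, rfl⟩; exact trace_mul_posSemidef_nonneg hP.1 hσ⟩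

theorem minTestValue_nonneg {ε : ℝ} {ρ σ : Matrix X X ℂ} (hσ : σ.PosSemidef) :
    0 ≤ minTestValue ε ρ σ :=
  Real.sInf_nonneg (by rintro _ ⟨P, hP, rfl⟩; exact trace_mul_posSemidef_nonneg hP.1 hσ)

theorem minTestValue_le {ε : ℝ} {ρ σ P : Matrix X X ℂ} (hσ : σ.PosSemidef)
    (hP : P ∈ acceptingTests ε ρ) : minTestValue ε ρ σ ≤ (P * σ).trace.re :=
  csInf_le (bddBelow_testValues hσ) ⟨P, hP, rfl⟩

theorem exists_test_lt {ε v : ℝ} (hε : 0 ≤ ε) {ρ σ : Matrix X X ℂ} (hρ : ρ.trace = 1)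
    (hv : minTestValue ε ρ σ < v) : ∃ P ∈ acceptingTests ε ρ, (P * σ).trace.re < v := by
  obtain ⟨_, ⟨P, hP, rfl⟩, h⟩ := exists_lt_of_csInf_lt
    (Set.Nonempty.image _ ⟨1, one_mem_acceptingTests hε hρ⟩) hv
  exact ⟨P, hP, h⟩

theorem minTestValue_mul_le {τ : Matrix (B × D) (B × D) ℂ} (hτ : IsState τ)
    {σ : Matrix D D ℂ} (hσ : σ.PosSemidef) {ε ε₁ ε₂ δ : ℝ} (hδ : 0 < δ) (h₁ : 0 ≤ ε₁)
    (h₂ : 0 ≤ ε₂) (hε : 17 * (ε₁ + δ) + 2 * ε₂ ≤ ε) :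
    δ * minTestValue ε τ (marginalFst τ ⊗ₖ σ)
      ≤ minTestValue ε₁ (marginalSnd τ) σ
        * minTestValue ε₂ τ (marginalFst τ ⊗ₖ marginalSnd τ) := by
  have hρ := marginalSnd_posSemidef hτ.posSemidef
  have hω := marginalFst_posSemidef hτ.posSemidef
  have hρ1 : (marginalSnd τ).trace = 1 := (trace_marginalSnd τ).trans hτ.trace_eq_one
  have hn₁ := minTestValue_nonneg (ε := ε₁) (ρ := marginalSnd τ) hσ
  have hn₂ := minTestValue_nonneg (ε := ε₂) (ρ := τ) (hω.kronecker hρ)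
  set β₁ := minTestValue ε₁ (marginalSnd τ) σ with hβ₁
  set β₂ := minTestValue ε₂ τ (marginalFst τ ⊗ₖ marginalSnd τ) with hβ₂
  -- The slack ξ avoids attainment of the infima and keeps μ = (β₁ + ξ)/δ positive even if β₁ = 0;
  -- then ξ → 0.
  have key : ∀ ξ : ℝ, 0 < ξ →
      δ * minTestValue ε τ (marginalFst τ ⊗ₖ σ) ≤ (β₁ + ξ) * (β₂ + ξ) := fun ξ hξ => by
    obtain ⟨P, hP, hPv⟩ := exists_test_lt h₁ hρ1 (lt_add_of_pos_right β₁ hξ)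
    obtain ⟨Q, hQ, hQv⟩ := exists_test_lt h₂ hτ.trace_eq_one (lt_add_of_pos_right β₂ hξ)
    have hμ : 0 < (β₁ + ξ) / δ := by positivity
    obtain ⟨T, hT, hTv⟩ := exists_composite_test hτ hσ (δ := δ) hμ hP hQ
      (by rw [div_mul_cancel₀ _ hδ.ne']; exact hPv.le)
    have hT' : T ∈ acceptingTests ε τ := ⟨hT.1, hT.2.1, by linarith [hT.2.2]⟩
    have h := (minTestValue_le (hω.kronecker hσ) hT').trans hTv
    calc δ * minTestValue ε τ (marginalFst τ ⊗ₖ σ)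
        ≤ δ * ((β₁ + ξ) / δ * (β₂ + ξ)) :=
          mul_le_mul_of_nonneg_left (h.trans (mul_le_mul_of_nonneg_left hQv.le hμ.le)) hδ.le
      _ = (β₁ + ξ) * (β₂ + ξ) := by field_simp
  have hlim : Filter.Tendsto (fun ξ : ℝ => (β₁ + ξ) * (β₂ + ξ)) (nhdsWithin 0 (Set.Ioi 0))
      (nhds (β₁ * β₂)) := by
    have : Continuous fun ξ : ℝ => (β₁ + ξ) * (β₂ + ξ) := by fun_prop
    simpa using (this.tendsto 0).mono_left nhdsWithin_le_nhds
  exact ge_of_tendsto hlim (Filter.eventually_of_mem self_mem_nhdsWithin key)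

theorem minTestValue_submatrix {Y : Type*} [Fintype Y] [DecidableEq Y] (e : Y ≃ X) (ε : ℝ)
    (ρ σ : Matrix X X ℂ) :
    minTestValue ε (ρ.submatrix e e) (σ.submatrix e e) = minTestValue ε ρ σ := by
  have htr : ∀ P S : Matrix X X ℂ, (P.submatrix e e * S.submatrix e e).trace = (P * S).trace :=
    fun P S => by
      rw [submatrix_mul_equiv]
      exact Fintype.sum_equiv e _ _ fun _ => rfl
  have hone : ∀ P : Matrix X X ℂ, 1 - P.submatrix e e = (1 - P).submatrix e e := fun P => by
    rw [submatrix_sub, Pi.sub_apply, Pi.sub_apply, submatrix_one_equiv]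
  unfold minTestValue
  congr 1
  ext v
  constructor
  · rintro ⟨P, ⟨h1, h2, h3⟩, rfl⟩
    obtain ⟨R, rfl⟩ : ∃ R : Matrix X X ℂ, R.submatrix e e = P :=
      ⟨P.submatrix e.symm e.symm, by simp⟩
    rw [htr] at h3
    rw [hone] at h2
    exact ⟨R, ⟨(posSemidef_submatrix_equiv e).1 h1, (posSemidef_submatrix_equiv e).1 h2, h3⟩,
      by simp only [htr]⟩
  · rintro ⟨P, ⟨h1, h2, h3⟩, rfl⟩
    exact ⟨P.submatrix e e, ⟨h1.submatrix e, by rw [hone]; exact h2.submatrix e, by rwa [htr]⟩,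
      by simp only [htr]⟩

end Tests

/-! ### From errors to entropies. -/

section Entropy

theorem hypothesisTestingEntropy_add_le {X Y Z : Type*} [Fintype X] [Fintype Y] [Fintype Z]
    [DecidableEq X] [DecidableEq Y] [DecidableEq Z] {ε ε₁ ε₂ δ k : ℝ}
    {ρ₁ σ₁ : Matrix X X ℂ} {ρ₂ σ₂ : Matrix Y Y ℂ} {ρ σ : Matrix Z Z ℂ}
    (hσ₁ : σ₁.PosSemidef) (hσ₂ : σ₂.PosSemidef) (hσ : σ.PosSemidef)
    (hδ : 0 < δ) (hk : -Real.logb 2 δ ≤ k)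
    (h : δ * minTestValue ε ρ σ ≤ minTestValue ε₁ ρ₁ σ₁ * minTestValue ε₂ ρ₂ σ₂) :
    hypothesisTestingEntropy ε₁ ρ₁ σ₁ + hypothesisTestingEntropy ε₂ ρ₂ σ₂ - (k : EReal)
      ≤ hypothesisTestingEntropy ε ρ σ := by
  have h0 := minTestValue_nonneg (ε := ε) (ρ := ρ) hσ
  have h1 := minTestValue_nonneg (ε := ε₁) (ρ := ρ₁) hσ₁
  have h2 := minTestValue_nonneg (ε := ε₂) (ρ := ρ₂) hσ₂
  unfold hypothesisTestingEntropy
  generalize minTestValue ε ρ σ = β at *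
  generalize minTestValue ε₁ ρ₁ σ₁ = β₁ at *
  generalize minTestValue ε₂ ρ₂ σ₂ = β₂ at *
  by_cases hβ : β = 0
  · simp [hβ]
  have hpos : 0 < β := lt_of_le_of_ne h0 (Ne.symm hβ)
  -- A finite right-hand side thus excludes infinite entropies on the left.
  have hprod : 0 < β₁ * β₂ := (mul_pos hδ hpos).trans_le h
  have hβ₁ : β₁ ≠ 0 := fun h => by simp [h] at hprod
  have hβ₂ : β₂ ≠ 0 := fun h => by simp [h] at hprod
  rw [if_neg hβ, if_neg hβ₁, if_neg hβ₂]
  norm_cast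
  have hlog := Real.logb_le_logb_of_le (b := 2) (by norm_num) (mul_pos hδ hpos) h
  rw [Real.logb_mul hδ.ne' hβ, Real.logb_mul hβ₁ hβ₂] at hlog
  linarith

end Entropy

/-! ### IM-states and the main theorem. -/

section IMStates

variable {A B C : Type*}

/-- The regrouping of the index set of `ABC` as that of `B` and `AC`. -/
def regroupEquiv (A B C : Type*) : B × (A × C) ≃ (A × B) × C where
  toFun x := ((x.2.1, x.1), x.2.2)
  invFun y := (y.1.2, (y.1.1, y.2))
  left_inv _ := rfl
  right_inv _ := rfl

variable [Fintype A] [Fintype B] [Fintype C]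

theorem regroupBAC_isState {ρ : Matrix ((A × B) × C) ((A × B) × C) ℂ} (hρ : IsState ρ) :
    IsState (regroupBAC ρ) :=
  ⟨hρ.posSemidef.submatrix _,
    (Fintype.sum_equiv (regroupEquiv A B C) _ _ fun _ => rfl).trans hρ.trace_eq_one⟩

/-- The only place where ρ^{AB} = ρ^A ⊗ ρ^B enters. -/
theorem IsIMState.submatrix_marginals {ρ : Matrix ((A × B) × C) ((A × B) × C) ℂ}
    (hρ : IsIMState ρ) :
    (marginalFst ρ ⊗ₖ marginalSnd ρ).submatrix (regroupEquiv A B C) (regroupEquiv A B C)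
      = marginalFst (regroupBAC ρ)
        ⊗ₖ (marginalFst (marginalAC ρ) ⊗ₖ marginalSnd (marginalAC ρ)) := by
  have hA : marginalFst (marginalFst ρ) = marginalFst (marginalAC ρ) := by
    ext a a'
    simp only [marginalFst, marginalAC, of_apply]
    exact Finset.sum_comm
  have hB : marginalSnd (marginalFst ρ) = marginalFst (regroupBAC ρ) := by
    ext b b'
    simp [marginalFst, marginalSnd, regroupBAC, Fintype.sum_prod_type]
  have hC : marginalSnd ρ = marginalSnd (marginalAC ρ) := by
    ext c c'
    simp [marginalAC, marginalSnd, Fintype.sum_prod_type]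
  rw [hρ.2, hA, hB, hC]
  ext ⟨b, a, c⟩ ⟨b', a', c'⟩
  simp only [submatrix_apply, kronecker_apply, regroupEquiv, Equiv.coe_fn_mk]
  ring

end IMStates

theorem proposition1 :
    ∃ c₁ c₂ K : ℝ, 0 < c₁ ∧ 0 < c₂ ∧ 0 < K ∧
      ∀ (A : Type*) (B : Type*) (C : Type*) [Fintype A] [Fintype B] [Fintype C]
        [DecidableEq A] [DecidableEq B] [DecidableEq C]
        (ρ : Matrix ((A × B) × C) ((A × B) × C) ℂ), IsIMState ρ →
        ∀ ε : ℝ, 0 < ε → ε < 1 →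
          hypothesisTestingInfo (c₁ * ε ^ 2) (marginalAC ρ)
              + hypothesisTestingInfo (c₂ * ε ^ 2) (regroupBAC ρ)
              - ((K * Real.logb 2 (2 / ε) : ℝ) : EReal)
            ≤ hypothesisTestingInfo ε ρ := by
  -- With δ = ε/64 the acceptance loss is (17ε + 19ε²)/64 ≤ ε, and log₂(64/ε) = 6 + log₂(1/ε) ≤ 6
  -- log₂(2/ε).
  refine ⟨1 / 64, 1 / 64, 6, by norm_num, by norm_num, by norm_num, ?_⟩
  intro A B C _ _ _ _ _ _ ρ hρ ε hε0 hε1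
  have hτ := regroupBAC_isState hρ.1
  have hAC : (marginalAC ρ).PosSemidef := marginalSnd_posSemidef hτ.posSemidef
  have hσ := (marginalFst_posSemidef hAC).kronecker (marginalSnd_posSemidef hAC)
  have h := minTestValue_mul_le hτ hσ (ε := ε) (ε₁ := 1 / 64 * ε ^ 2) (ε₂ := 1 / 64 * ε ^ 2)
    (δ := ε / 64) (by positivity) (by positivity) (by positivity) (by nlinarith)
  have hreg : regroupBAC ρ = ρ.submatrix (regroupEquiv A B C) (regroupEquiv A B C) := rfl
  rw [← hρ.submatrix_marginals] at h
  conv at h => lhs; rw [hreg, minTestValue_submatrix]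
  refine hypothesisTestingEntropy_add_le hσ
    ((marginalFst_posSemidef hτ.posSemidef).kronecker (marginalSnd_posSemidef hτ.posSemidef))
    ((marginalFst_posSemidef hρ.1.posSemidef).kronecker (marginalSnd_posSemidef hρ.1.posSemidef))
    (δ := ε / 64) (by positivity) ?_ h
  have h64 : Real.logb 2 64 = 6 := by
    rw [show (64 : ℝ) = 2 ^ (6 : ℝ) by norm_num, Real.logb_rpow] <;> norm_num
  have hneg : Real.logb 2 ε ≤ 0 := Real.logb_nonpos (by norm_num) hε0.le hε1.le
  rw [Real.logb_div hε0.ne' (by norm_num), Real.logb_div (by norm_num) hε0.ne', h64,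
    Real.logb_self_eq_one (by norm_num)]
  linarith
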